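/- Let $[n]=\{1,\dots,n\}$ and let $\binom{[n]}{k}$ be the set of $k$-element subsets of $[n]$. The Johnson graph $J(n,k)$ ($1\le k\le n$) has vertex set $\binom{[n]}{k}$, with $A,B$ adjacent iff $|A\cap B|=k-1$. The Kneser graph $K(n,k)$ ($k\ge 1$, $n>2k$) has the same vertex set, with $A,B$ adjacent iff $A\cap B=\emptyset$. For a graph $G$, the power $G^p$ has the same vertices as $G$, and $u,v$ are adjacent in $G^p$ iff $1\le d_G(u,v)\le p$, where $d_G$ is the shortest-path distance. $A(G)$ is the adjacency matrix of $G$ and $\mathrm{Spec}$ denotes the set of eigenvalues. The Eberlein polynomials are $$\mathcal E_i(x;n,k)=\sum_{t=0}^{i}(-1)^t\binom{x}{t}\binom{k-x}{i-t}\binom{n-k-x}{i-t},$$ and for $n>2k$ let $\delta_{n,k}:\{0,1,\dots,k\}\to\mathbb Z_{\ge 0}$ be $$\delta_{n,k}(i)=\min\left\{2\left\lceil\frac{i}{n-2k}\right\rceil,\;2\left\lceil\frac{k-i}{n-2k}\right\rceil+1\right\}.$$ **Lemma 4.2.** Let $k\ge 1$. (i) For all $n\ge k$ and $1\le p\le \min\{k,n-k\}$,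 put $\lambda_j=\sum_{i=1}^p\mathcal E_i(j;n,k)$. Then $$\mathrm{Spec}\bigl(A(J(n,k)^p)\bigr)=\{\lambda_j \mid 0\le j\le \min\{k,n-k\}\}.$$ The maximum eigenvalue is $\lambda_0=\sum_{i=1}^p\binom{k}{i}\binom{n-k}{i}$, and the set of the other eigenvalues is $\mathrm{Spec}(A(J(n,k)^p))\setminus\{\lambda_0\}=\{\lambda_j\mid 1\le j\le\min\{k,n-k\}\}$. (In particular, when $n\ge 2k$ the index $j$ runs up to $k$.) (ii) For all $n>2k$ and $1\le p\le\left\lceil\frac{k-1}{n-2k}\right\rceil+1$, put $S=\delta_{n,k}^{-1}(\{1,\dots,p\})$ and $\lambda_j=\sum_{i\in S}\mathcal E_i(j;n,k)$. Then $$\mathrm{Spec}\bigl(A(K(n,k)^p)\bigr)=\{\lambda_j \mid 0\le j\le k\}.$$ The maximum eigenvalue is $\lambda_0=\sum_{i\in S}\binom{k}{i}\binom{n-k}{i}$, and the set of the other eigenvalues is $\mathrm{Spec}(A(K(n,k)^p))\setminus\{\lambda_0\}=\{\lambda_j\mid 1\le j\le k\}$. In both cases the minimum eigenvalue is negative. 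-/

import Mathlib

namespace GraphPower

/-- The `p`-th power of a graph: distinct vertices are adjacent when they are joined by a path of
length at most `p`. (`SimpleGraph.dist` is `0` for vertices in different components, so these are
never adjacent in the power.) -/
def power {V : Type*} (G : SimpleGraph V) (p : ℕ) : SimpleGraph V where
  Adj u v := 1 ≤ G.dist u v ∧ G.dist u v ≤ p
  symm := ⟨fun u v h => by rwa [SimpleGraph.dist_comm]⟩
  loopless := ⟨fun u h => by simp at h⟩

/-- The `k`-element subsets of an `n`-element set. -/
abbrev KSubset (n k : ℕ) : Type := {A : Finset (Fin n) // A.card = k}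

/-- The Johnson graph `J(n, k)`: `A` and `B` are adjacent when `|A ∩ B| = k - 1`. -/
def johnson (n k : ℕ) : SimpleGraph (KSubset n k) where
  Adj A B := (A.1 ∩ B.1).card + 1 = k
  symm := ⟨fun A B h => by rwa [Finset.inter_comm]⟩
  loopless := ⟨fun A h => by
    rw [Finset.inter_self, A.2] at h
    omega⟩

/-- The Kneser graph `K(n, k)`: distinct vertices are adjacent when they are disjoint sets
(distinctness is automatic for `k ≥ 1`). -/
def kneser (n k : ℕ) : SimpleGraph (KSubset n k) where
  Adj A B := A ≠ B ∧ Disjoint A.1 B.1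
  symm := ⟨fun _ _ h => ⟨h.1.symm, h.2.symm⟩⟩
  loopless := ⟨fun _ h => h.1 rfl⟩

open Classical in
/-- The set of eigenvalues of the (real, symmetric) adjacency matrix of a finite graph. -/
def adjSpec {V : Type*} [Fintype V] (G : SimpleGraph V) : Set ℝ :=
  {μ : ℝ | Module.End.HasEigenvalue (Matrix.toLin' (G.adjMatrix ℝ)) μ}

/-- The Eberlein polynomial `ℰ_i(x; n, k)`, evaluated at an integer `x`. The binomial coefficients
are the polynomial ones, `Ring.choose y r = y (y - 1) ⋯ (y - r + 1) / r!`. -/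
def eberlein (i : ℕ) (x : ℤ) (n k : ℕ) : ℤ :=
  ∑ t ∈ Finset.range (i + 1), (-1) ^ t * Ring.choose x t *
    Ring.choose ((k : ℤ) - x) (i - t) * Ring.choose ((n : ℤ) - k - x) (i - t)

/-- The function `δ_{n,k}(i) = min {2⌈i / (n - 2k)⌉, 2⌈(k - i) / (n - 2k)⌉ + 1}`, used for
`n > 2k` and `0 ≤ i ≤ k`; here `a ⌈/⌉ b` is the ceiling of the fraction `a / b`. -/
def delta (n k i : ℕ) : ℕ :=
  min (2 * (i ⌈/⌉ (n - 2 * k))) (2 * ((k - i) ⌈/⌉ (n - 2 * k)) + 1)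

/-- The preimage of `[p] = {1, …, p}` under `δ_{n,k} : {0, …, k} → ℕ`. -/
def deltaPreimage (n k p : ℕ) : Finset ℕ :=
  {i ∈ Finset.range (k + 1) | delta n k i ∈ Finset.Icc 1 p}

end GraphPower

namespace GraphPower

/-! In both graphs the distance from `A` to `B` depends only on `|A \ B|`: it is `|A \ B|` itself
for Johnson and `δ` of it for Kneser. The adjacency matrix of a power is therefore a sum over `i ∈
S` of the distance-`i` matrices of the Johnson scheme.

For `j` disjoint pairs of points, the product of the differences `[a r ∈ B] - [b r ∈ B]` is a common
eigenvector of these matrices, with eigenvalue `ℰ_i(j)` (`sum_pairProd`). To see that no eigenvalue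
is missed, only one eigenvector per `j` is needed. Matrices invariant under the symmetric group form
a space of dimension at most `min k (n - k) + 1`. Since the `ℰ_1(j)` are distinct, polynomials in
the Johnson matrix realise every tuple of eigenvalues on the chosen vectors. Hence an invariant
matrix killing all of them is zero, and `∏ j, (M - λ_j) = 0`.

The eigenvectors are bounded by `1` and attain it, so `λ_j ≤ λ_0`; connectedness makes this strict
for `j ≥ 1`. A negative eigenvalue exists because the trace is zero and there is an edge. -/

variable {n k : ℕ}

/-! ### Distances in the Johnson graph -/

theorem card_inter_add_card_sdiff (A B : KSubset n k) :
    (A.1 ∩ B.1).card + (A.1 \ B.1).card = k := by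
  rw [Finset.card_inter_add_card_sdiff, A.2]

theorem card_sdiff_comm (A B : KSubset n k) : (A.1 \ B.1).card = (B.1 \ A.1).card := by
  have h1 := card_inter_add_card_sdiff A B
  have h2 := card_inter_add_card_sdiff B A
  rw [Finset.inter_comm] at h2
  omega

theorem card_sdiff_eq_zero_iff (A B : KSubset n k) : (A.1 \ B.1).card = 0 ↔ A = B := by
  rw [Finset.card_eq_zero, Finset.sdiff_eq_empty_iff_subset]
  constructor
  · intro h
    exact Subtype.ext (Finset.eq_of_subset_of_card_le h (by rw [A.2, B.2]))
  · rintro rfl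
    exact Finset.Subset.refl _

theorem card_sdiff_le_left (A B : KSubset n k) : (A.1 \ B.1).card ≤ k := by
  have := card_inter_add_card_sdiff A B
  omega

theorem card_sdiff_le (A B : KSubset n k) : (A.1 \ B.1).card ≤ min k (n - k) := by
  refine le_min (card_sdiff_le_left A B) ?_
  have h : (A.1 \ B.1) ⊆ B.1ᶜ := by
    intro x hx
    simp at hx ⊢
    exact hx.2
  have := Finset.card_le_card h
  rwa [Finset.card_compl, B.2, Fintype.card_fin] at this

theorem johnson_adj_iff (A B : KSubset n k) :
    (johnson n k).Adj A B ↔ (A.1 \ B.1).card = 1 := by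
  have := card_inter_add_card_sdiff A B
  change (A.1 ∩ B.1).card + 1 = k ↔ _
  omega

theorem card_sdiff_le_length {A B : KSubset n k} (w : (johnson n k).Walk A B) :
    (A.1 \ B.1).card ≤ w.length := by
  induction w with
  | nil => simp
  | @cons A C B h w ih =>
    rw [johnson_adj_iff] at h
    have hsub : A.1 \ B.1 ⊆ (A.1 \ C.1) ∪ (C.1 \ B.1) := by
      intro x
      simp only [Finset.mem_sdiff, Finset.mem_union]
      tauto
    have := (Finset.card_le_card hsub).trans (Finset.card_union_le _ _)
    rw [SimpleGraph.Walk.length_cons]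
    omega

/-- Exchanging a point of `A \ B` for a point of `B \ A` is one step and lowers `|A \ B|` by exactly
one. -/
theorem exists_johnson_walk (i : ℕ) (A B : KSubset n k) (h : (A.1 \ B.1).card = i) :
    ∃ w : (johnson n k).Walk A B, w.length = i := by
  induction i generalizing A with
  | zero =>
    obtain rfl := (card_sdiff_eq_zero_iff A B).1 h
    exact ⟨.nil, rfl⟩
  | succ i ih =>
    obtain ⟨x, hx⟩ : (A.1 \ B.1).Nonempty := Finset.card_pos.1 (by omega)
    obtain ⟨y, hy⟩ : (B.1 \ A.1).Nonempty := Finset.card_pos.1 (by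
      rw [card_sdiff_comm B A]; omega)
    rw [Finset.mem_sdiff] at hx hy
    have hxy : y ≠ x := fun e => hx.2 (e ▸ hy.1)
    let C : KSubset n k := ⟨insert y (A.1.erase x), by
      rw [Finset.card_insert_of_notMem (by simp [hy.2]), Finset.card_erase_of_mem hx.1, A.2]
      have := Finset.card_pos.2 ⟨x, hx.1⟩
      rw [A.2] at this
      omega⟩
    have hAC : A.1 \ C.1 = {x} := by
      ext z
      simp only [C, Finset.mem_sdiff, Finset.mem_insert, Finset.mem_erase, Finset.mem_singleton]
      grind
    have hCB : C.1 \ B.1 = (A.1 \ B.1).erase x := by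
      ext z
      simp only [C, Finset.mem_sdiff, Finset.mem_insert, Finset.mem_erase]
      grind
    have hcard : (C.1 \ B.1).card = i := by
      rw [hCB, Finset.card_erase_of_mem (by simp [hx]), h]
      rfl
    obtain ⟨w, hw⟩ := ih C hcard
    exact ⟨.cons ((johnson_adj_iff A C).2 (by rw [hAC]; rfl)) w, by
      rw [SimpleGraph.Walk.length_cons, hw]⟩

theorem johnson_preconnected : (johnson n k).Preconnected := fun A B =>
  let ⟨w, _⟩ := exists_johnson_walk _ A B rfl
  ⟨w⟩

theorem johnson_dist (A B : KSubset n k) : (johnson n k).dist A B = (A.1 \ B.1).card := by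
  obtain ⟨w, hw⟩ := exists_johnson_walk _ A B rfl
  obtain ⟨v, hv⟩ := (johnson_preconnected A B).exists_walk_length_eq_dist
  have h1 := card_sdiff_le_length v
  have h2 := SimpleGraph.dist_le w
  omega

/-! ### Distances in the Kneser graph -/

theorem kneser_adj_iff (hk : 1 ≤ k) (A B : KSubset n k) :
    (kneser n k).Adj A B ↔ Disjoint A.1 B.1 := by
  refine ⟨fun h => h.2, fun h => ⟨?_, h⟩⟩
  rintro rfl
  rw [disjoint_self, Finset.bot_eq_empty, ← Finset.card_eq_zero, A.2] at h
  omega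

/-- A `k`-set disjoint from `A` meeting `B` in a prescribed number of points. -/
theorem exists_disjoint_card_inter (A B : KSubset n k) (s : ℕ) (hs : s ≤ (A.1 \ B.1).card)
    (h : 2 * k + (A.1 \ B.1).card ≤ n + s) :
    ∃ C : KSubset n k, Disjoint A.1 C.1 ∧ (C.1 ∩ B.1).card = s := by
  have hi := card_sdiff_le_left A B
  rw [card_sdiff_comm] at hs h hi
  have hU : (A.1 ∪ B.1)ᶜ.card = n - (k + (B.1 \ A.1).card) := by
    rw [Finset.card_compl, Fintype.card_fin, ← Finset.union_sdiff_self_eq_union,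
      Finset.card_union_of_disjoint Finset.disjoint_sdiff, A.2]
  obtain ⟨X, hX, hXc⟩ := Finset.exists_subset_card_eq hs
  obtain ⟨Y, hY, hYc⟩ := Finset.exists_subset_card_eq
    (show k - s ≤ (A.1 ∪ B.1)ᶜ.card by omega)
  have hX' : ∀ z ∈ X, z ∈ B.1 ∧ z ∉ A.1 := fun z hz => by simpa using hX hz
  have hY' : ∀ z ∈ Y, z ∉ A.1 ∧ z ∉ B.1 := fun z hz => by simpa using hY hz
  refine ⟨⟨X ∪ Y, ?_⟩, ?_, ?_⟩
  · rw [Finset.card_union_of_disjoint, hXc, hYc]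
    · omega
    · rw [Finset.disjoint_left]
      exact fun z hz hz' => (hY' z hz').2 (hX' z hz).1
  · rw [Finset.disjoint_left]
    intro z hz hz'
    rcases Finset.mem_union.1 hz' with h | h
    · exact (hX' z h).2 hz
    · exact (hY' z h).1 hz
  · have : (X ∪ Y) ∩ B.1 = X := by
      ext z
      simp only [Finset.mem_inter, Finset.mem_union]
      have := hX' z
      have := hY' z
      tauto
    change ((X ∪ Y) ∩ B.1).card = s
    rw [this, hXc]

/-- Walks of an exact length allow an induction alternating between the parities. With `i = |A \
B|`, a first step to `C` disjoint from `A` can realise `|C ∩ B| = s` exactly when `i - (n - 2k) ≤ s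
≤ i`, `s ≥ 0`. Odd lengths want `s` as large as possible, even lengths as small as possible. -/
theorem exists_kneser_walk_iff (hk : 1 ≤ k) (hn : 2 * k < n) (q : ℕ) :
    (∀ A B : KSubset n k, (∃ w : (kneser n k).Walk A B, w.length = 2 * q) ↔
      (A.1 \ B.1).card ≤ q * (n - 2 * k)) ∧
    (∀ A B : KSubset n k, (∃ w : (kneser n k).Walk A B, w.length = 2 * q + 1) ↔
      k - (A.1 \ B.1).card ≤ q * (n - 2 * k)) := by
  have hstep : ∀ (l : ℕ) (A B : KSubset n k),
      (∃ w : (kneser n k).Walk A B, w.length = l + 1) ↔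
        ∃ C : KSubset n k, Disjoint A.1 C.1 ∧ ∃ w : (kneser n k).Walk C B, w.length = l := by
    intro l A B
    constructor
    · rintro ⟨w, hw⟩
      cases w with
      | nil => simp at hw
      | @cons _ C _ h w =>
        exact ⟨C, (kneser_adj_iff hk _ _).1 h, w, by simpa using hw⟩
    · rintro ⟨C, hC, w, hw⟩
      exact ⟨.cons ((kneser_adj_iff hk _ _).2 hC) w, by simp [hw]⟩
  have hodd : ∀ q : ℕ, (∀ A B : KSubset n k, (∃ w : (kneser n k).Walk A B, w.length = 2 * q) ↔
      (A.1 \ B.1).card ≤ q * (n - 2 * k)) →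
      (∀ A B : KSubset n k, (∃ w : (kneser n k).Walk A B, w.length = 2 * q + 1) ↔
        k - (A.1 \ B.1).card ≤ q * (n - 2 * k)) := by
    intro q ih A B
    rw [hstep]
    simp only [ih]
    constructor
    · rintro ⟨C, hAC, hC⟩
      have h1 := card_inter_add_card_sdiff C B
      have h2 : (C.1 ∩ B.1).card ≤ (B.1 \ A.1).card := by
        refine Finset.card_le_card fun z hz => ?_
        rw [Finset.mem_inter] at hz
        exact Finset.mem_sdiff.2 ⟨hz.2, fun h => Finset.disjoint_left.1 hAC h hz.1⟩
      rw [card_sdiff_comm B A] at h2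
      omega
    · intro h
      have hi := card_sdiff_le_left A B
      obtain ⟨C, hC, hCB⟩ := exists_disjoint_card_inter A B _ le_rfl (by omega)
      have h1 := card_inter_add_card_sdiff C B
      exact ⟨C, hC, by omega⟩
  have heven : ∀ q : ℕ, (∀ A B : KSubset n k, (∃ w : (kneser n k).Walk A B, w.length = 2 * q) ↔
      (A.1 \ B.1).card ≤ q * (n - 2 * k)) := by
    intro q
    induction q with
    | zero =>
      intro A B
      rw [zero_mul, Nat.le_zero, card_sdiff_eq_zero_iff]
      constructor
      · rintro ⟨w, hw⟩
        exact SimpleGraph.Walk.eq_of_length_eq_zero hw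
      · rintro rfl
        exact ⟨.nil, rfl⟩
    | succ q ih =>
      intro A B
      rw [show 2 * (q + 1) = (2 * q + 1) + 1 by ring, hstep]
      simp only [hodd q ih]
      rw [add_mul, one_mul]
      have hi := card_sdiff_le_left A B
      constructor
      · rintro ⟨C, hAC, hC⟩
        have h1 := card_inter_add_card_sdiff C B
        -- Only `n - 2k` points lie outside `A ∪ C`, so `C` must contain all but that many points of
        -- `B \ A`.
        have hsub : B.1 \ A.1 ⊆ (C.1 ∩ B.1) ∪ (A.1 ∪ C.1)ᶜ := by
          intro z
          simp only [Finset.mem_sdiff, Finset.mem_union, Finset.mem_inter, Finset.mem_compl]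
          tauto
        have h2 := (Finset.card_le_card hsub).trans (Finset.card_union_le _ _)
        rw [Finset.card_compl, Fintype.card_fin, Finset.card_union_of_disjoint hAC, A.2, C.2,
          card_sdiff_comm B A] at h2
        omega
      · intro h
        -- Truncated subtraction gives the least possible intersection, including `0` when `|A \ B|
        -- ≤ n - 2k`.
        obtain ⟨C, hC, hCB⟩ := exists_disjoint_card_inter A B
          ((A.1 \ B.1).card - (n - 2 * k)) (by omega) (by omega)
        have h1 := card_inter_add_card_sdiff C B
        exact ⟨C, hC, by omega⟩
  exact ⟨heven q, hodd q (heven q)⟩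

theorem kneser_preconnected (hk : 1 ≤ k) (hn : 2 * k < n) : (kneser n k).Preconnected := by
  intro A B
  -- Length `2k` always suffices, since `|A \ B| ≤ k` and `n - 2k ≥ 1`.
  obtain ⟨w, _⟩ := ((exists_kneser_walk_iff hk hn k).1 A B).2
    ((card_sdiff_le_left A B).trans (Nat.le_mul_of_pos_right _ (by omega)))
  exact ⟨w⟩

theorem kneser_dist (hk : 1 ≤ k) (hn : 2 * k < n) (A B : KSubset n k) :
    (kneser n k).dist A B = delta n k (A.1 \ B.1).card := by
  have hm : 0 < n - 2 * k := by omega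
  have hle : ∀ a q : ℕ, a ≤ q * (n - 2 * k) ↔ a ⌈/⌉ (n - 2 * k) ≤ q := fun a q => by
    rw [ceilDiv_le_iff_le_mul hm, mul_comm]
  apply le_antisymm
  · refine le_min ?_ ?_
    · obtain ⟨w, hw⟩ := ((exists_kneser_walk_iff hk hn _).1 A B).2 ((hle _ _).2 le_rfl)
      exact hw ▸ SimpleGraph.dist_le w
    · obtain ⟨w, hw⟩ := ((exists_kneser_walk_iff hk hn _).2 A B).2 ((hle _ _).2 le_rfl)
      exact hw ▸ SimpleGraph.dist_le w
  · obtain ⟨w, hw⟩ := (kneser_preconnected hk hn A B).exists_walk_length_eq_dist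
    rw [← hw]
    rcases Nat.even_or_odd' w.length with ⟨q, hq | hq⟩
    · have := (hle _ _).1 (((exists_kneser_walk_iff hk hn q).1 A B).1 ⟨w, hq⟩)
      exact (min_le_left _ _).trans (by omega)
    · have := (hle _ _).1 (((exists_kneser_walk_iff hk hn q).2 A B).1 ⟨w, hq⟩)
      exact (min_le_right _ _).trans (by omega)

/-! ### Powers as unions of relations of the Johnson scheme -/

theorem power_preconnected {V : Type*} {G : SimpleGraph V} (hG : G.Preconnected) {p : ℕ}
    (hp : 1 ≤ p) : (power G p).Preconnected := by
  refine hG.mono fun u v h => ?_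
  change 1 ≤ G.dist u v ∧ G.dist u v ≤ p
  rw [SimpleGraph.dist_eq_one_iff_adj.2 h]
  exact ⟨le_rfl, hp⟩

theorem power_johnson_adj_iff (p : ℕ) (A B : KSubset n k) :
    (power (johnson n k) p).Adj A B ↔ (A.1 \ B.1).card ∈ Finset.Icc 1 p := by
  change 1 ≤ (johnson n k).dist A B ∧ (johnson n k).dist A B ≤ p ↔ _
  rw [johnson_dist, Finset.mem_Icc]

theorem power_kneser_adj_iff (hk : 1 ≤ k) (hn : 2 * k < n) (p : ℕ) (A B : KSubset n k) :
    (power (kneser n k) p).Adj A B ↔ (A.1 \ B.1).card ∈ deltaPreimage n k p := by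
  change 1 ≤ (kneser n k).dist A B ∧ (kneser n k).dist A B ≤ p ↔ _
  rw [kneser_dist hk hn, deltaPreimage, Finset.mem_filter, Finset.mem_Icc, Finset.mem_range,
    Nat.lt_succ_iff]
  exact ⟨fun h => ⟨card_sdiff_le_left A B, h⟩, fun h => h.2⟩

/-! ### Common eigenvectors of the Johnson scheme -/

/-- The product of differences of indicators `∏ r, ([a r ∈ B] - [b r ∈ B])`. -/
noncomputable def pairProd {j : ℕ} (a b : Fin j → Fin n) (B : Finset (Fin n)) : ℝ :=
  ∏ r, ((if a r ∈ B then 1 else 0) - (if b r ∈ B then 1 else 0))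

theorem pairProd_eq_neg_one_pow {j : ℕ} (a b : Fin j → Fin n) (B : Finset (Fin n))
    (h : ∀ r, a r ∈ B ↔ b r ∉ B) :
    pairProd a b B = (-1) ^ (Finset.univ.filter fun r => a r ∉ B).card := by
  rw [← Finset.prod_const, Finset.prod_filter]
  refine Finset.prod_congr rfl fun r _ => ?_
  by_cases h1 : b r ∈ B
  · have := (h r).not.2 (not_not.2 h1)
    simp [h1, this]
  · simp [h1, (h r).2 h1]

theorem pairProd_eq_zero {j : ℕ} (a b : Fin j → Fin n) (B : Finset (Fin n)) (r : Fin j)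
    (h : a r ∈ B ↔ b r ∈ B) : pairProd a b B = 0 :=
  Finset.prod_eq_zero (Finset.mem_univ r) (by simp [h])

theorem eberlein_eq (i j : ℕ) (hj : j ≤ k) (hn : j ≤ n - k) (hkn : k ≤ n) :
    (eberlein i j n k : ℝ) = ∑ t ∈ Finset.range (i + 1),
      (-1) ^ t * (j.choose t : ℝ) * ((k - j).choose (i - t)) * ((n - k - j).choose (i - t)) := by
  have h1 : (k : ℤ) - j = ((k - j : ℕ) : ℤ) := by omega
  have h2 : (n : ℤ) - k - j = ((n - k - j : ℕ) : ℤ) := by omega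
  simp only [eberlein, h1, h2, Ring.choose_natCast]
  push_cast
  rfl

section Transversal

variable {j : ℕ} {a b : Fin j → Fin n} {A : Finset (Fin n)}

set_option maxHeartbeats 1000000 in
-- Only sets `B` with exactly one point from each pair contribute. Such a `B` arises from `A` by
-- replacing `a r` with `b r` for `r` in a `t`-set of indices, removing `i - t` other points of `A`
-- and adding `i - t` other points outside it. Its sign is `(-1)^t`, and counting these choices
-- gives the Eberlein sum.
theorem sum_pairProd_of_transversal (hA : A.card = k) (ha : Function.Injective a)
    (hb : Function.Injective b) (haA : ∀ r, a r ∈ A) (hbA : ∀ r, b r ∉ A) (i : ℕ) :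
    ∑ B ∈ (Finset.powersetCard k Finset.univ).filter (fun B => (A \ B).card = i),
      pairProd a b B = eberlein i j n k := by
  have hcardP : (A \ Finset.univ.image a).card = k - j := by
    rw [Finset.card_sdiff_of_subset (by intro z; simp; rintro r rfl; exact haA r),
      Finset.card_image_of_injective _ ha, hA]
    simp
  have hcardQ : (Aᶜ \ Finset.univ.image b).card = n - k - j := by
    rw [Finset.card_sdiff_of_subset (by intro z; simp; rintro r rfl; exact hbA r),
      Finset.card_image_of_injective _ hb, Finset.card_compl, hA]
    simp
  have hjk : j ≤ k := by
    have := Finset.card_le_card (show Finset.univ.image a ⊆ A by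
      intro z; simp; rintro r rfl; exact haA r)
    rwa [Finset.card_image_of_injective _ ha, hA, Finset.card_univ, Fintype.card_fin] at this
  have hjn : j ≤ n - k := by
    have := Finset.card_le_card (show Finset.univ.image b ⊆ Aᶜ by
      intro z; simp; rintro r rfl; exact hbA r)
    rwa [Finset.card_image_of_injective _ hb, Finset.card_compl, hA, Finset.card_univ,
      Fintype.card_fin, Fintype.card_fin] at this
  have hkn : k ≤ n := by
    have := Finset.card_le_univ A
    rwa [hA, Fintype.card_fin] at this
  have hr : (eberlein i j n k : ℝ) = ∑ x ∈ (Finset.range (i + 1)).sigma (fun t =>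
      Finset.powersetCard t (Finset.univ : Finset (Fin j)) ×ˢ
        Finset.powersetCard (i - t) (A \ Finset.univ.image a) ×ˢ
        Finset.powersetCard (i - t) (Aᶜ \ Finset.univ.image b)), (-1 : ℝ) ^ x.1 := by
    rw [eberlein_eq i j hjk hjn hkn, Finset.sum_sigma]
    refine Finset.sum_congr rfl fun t _ => ?_
    simp only [Finset.sum_const, Finset.card_product, Finset.card_powersetCard, hcardP, hcardQ,
      Finset.card_univ, Fintype.card_fin, nsmul_eq_mul]
    push_cast
    ring
  have hl : ∑ B ∈ (Finset.powersetCard k Finset.univ).filter (fun B => (A \ B).card = i),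
      pairProd a b B = ∑ B ∈ ((Finset.powersetCard k Finset.univ).filter
        (fun B => (A \ B).card = i)).filter (fun B => ∀ r, a r ∈ B ↔ b r ∉ B),
        pairProd a b B := by
    refine (Finset.sum_filter_of_ne fun B _ hB => ?_).symm
    by_contra hcon
    push Not at hcon
    obtain ⟨r, hr⟩ := hcon
    exact hB (pairProd_eq_zero a b B r (by tauto))
  have hab : ∀ r s, a r ≠ b s := fun r s h => hbA s (h ▸ haA r)
  rw [hr, hl]
  -- `B` is encoded by `t`, the index set of the replaced pairs, the unpaired points removed from
  -- `A` and the unpaired points added.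
  refine Finset.sum_nbij'
    (fun B => ⟨(Finset.univ.filter fun r => a r ∉ B).card,
      (Finset.univ.filter fun r => a r ∉ B),
      (A \ Finset.univ.image a) \ B, B ∩ (Aᶜ \ Finset.univ.image b)⟩)
    (fun x => (A \ (x.2.1.image a ∪ x.2.2.1)) ∪ (x.2.1.image b ∪ x.2.2.2)) ?_ ?_ ?_ ?_ ?_
  · intro B hB
    simp only [Finset.mem_filter, Finset.mem_powersetCard, Finset.subset_univ, true_and] at hB
    obtain ⟨⟨hBk, hBi⟩, hBt⟩ := hB
    have h1 : A \ B = (Finset.univ.filter fun r => a r ∉ B).image a ∪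
        ((A \ Finset.univ.image a) \ B) := by
      ext z
      simp only [Finset.mem_sdiff, Finset.mem_union, Finset.mem_image, Finset.mem_filter,
        Finset.mem_univ, true_and]
      constructor
      · rintro ⟨hz, hzB⟩
        by_cases h : ∃ r, a r = z
        · obtain ⟨r, rfl⟩ := h
          exact Or.inl ⟨r, hzB, rfl⟩
        · exact Or.inr ⟨⟨hz, h⟩, hzB⟩
      · rintro (⟨r, hr, rfl⟩ | ⟨⟨hz, _⟩, hzB⟩)
        · exact ⟨haA r, hr⟩
        · exact ⟨hz, hzB⟩
    have h2 : B \ A = (Finset.univ.filter fun r => a r ∉ B).image b ∪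
        (B ∩ (Aᶜ \ Finset.univ.image b)) := by
      ext z
      simp only [Finset.mem_sdiff, Finset.mem_union, Finset.mem_image, Finset.mem_filter,
        Finset.mem_univ, true_and, Finset.mem_inter, Finset.mem_compl]
      constructor
      · rintro ⟨hz, hzA⟩
        by_cases h : ∃ r, b r = z
        · obtain ⟨r, rfl⟩ := h
          exact Or.inl ⟨r, fun h => (hBt r).1 h hz, rfl⟩
        · exact Or.inr ⟨hz, hzA, h⟩
      · rintro (⟨r, hr, rfl⟩ | ⟨hz, hzA, _⟩)
        · exact ⟨by_contra fun h => hr ((hBt r).2 h), hbA r⟩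
        · exact ⟨hz, hzA⟩
    -- Equal cardinalities give `|B \ A| = |A \ B|`, which fixes the number of added points.
    have h3 : (B \ A).card = i := by
      rw [← hBi]
      exact card_sdiff_comm ⟨B, hBk⟩ ⟨A, hA⟩
    rw [h1, Finset.card_union_of_disjoint, Finset.card_image_of_injective _ ha] at hBi
    swap
    · rw [Finset.disjoint_left]
      intro z
      simp
      rintro r - rfl - h
      exact absurd rfl (h r)
    rw [h2, Finset.card_union_of_disjoint, Finset.card_image_of_injective _ hb] at h3
    swap
    · rw [Finset.disjoint_left]
      intro z
      simp
      rintro r - rfl - -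
      exact ⟨r, rfl⟩
    simp only [Finset.mem_sigma, Finset.mem_range, Finset.mem_product, Finset.mem_powersetCard,
      Finset.subset_univ, true_and]
    exact ⟨by omega, ⟨Finset.sdiff_subset, by omega⟩, Finset.inter_subset_right, by omega⟩
  · rintro ⟨t, J, R, T⟩ hx
    simp only [Finset.mem_sigma, Finset.mem_range, Finset.mem_product, Finset.mem_powersetCard,
      Finset.subset_univ, true_and] at hx
    obtain ⟨ht, hJ, ⟨hR, hRc⟩, hT, hTc⟩ := hx
    have hR' : ∀ z ∈ R, z ∈ A ∧ ∀ r, a r ≠ z := fun z hz => by simpa using hR hz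
    have hT' : ∀ z ∈ T, z ∉ A ∧ ∀ r, b r ≠ z := fun z hz => by simpa using hT hz
    have hJA : J.image a ⊆ A := by
      intro z; simp; rintro r - rfl; exact haA r
    have hJB : ∀ z ∈ J.image b, z ∉ A := by
      intro z; simp; rintro r - rfl; exact hbA r
    have e1 : A \ ((A \ (J.image a ∪ R)) ∪ (J.image b ∪ T)) = J.image a ∪ R := by
      ext z
      have := hR' z
      have := hT' z
      have := hJB z
      have := @hJA z
      simp only [Finset.mem_sdiff, Finset.mem_union]
      tauto
    have c1 : (J.image a ∪ R).card = i := by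
      rw [Finset.card_union_of_disjoint, Finset.card_image_of_injective _ ha, hJ, hRc]
      · omega
      · rw [Finset.disjoint_left]
        intro z hz hz'
        obtain ⟨r, _, rfl⟩ := Finset.mem_image.1 hz
        exact (hR' _ hz').2 r rfl
    have c2 : (J.image b ∪ T).card = i := by
      rw [Finset.card_union_of_disjoint, Finset.card_image_of_injective _ hb, hJ, hTc]
      · omega
      · rw [Finset.disjoint_left]
        intro z hz hz'
        obtain ⟨r, _, rfl⟩ := Finset.mem_image.1 hz
        exact (hT' _ hz').2 r rfl
    simp only [Finset.mem_filter, Finset.mem_powersetCard, Finset.subset_univ, true_and]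
    refine ⟨⟨?_, ?_⟩, ?_⟩
    · rw [Finset.card_union_of_disjoint, Finset.card_sdiff_of_subset, c1, c2, hA]
      · have := Finset.card_le_card (show J.image a ∪ R ⊆ A from
          Finset.union_subset hJA fun z hz => (hR' z hz).1)
        omega
      · exact Finset.union_subset hJA fun z hz => (hR' z hz).1
      · rw [Finset.disjoint_left]
        intro z hz hz'
        rcases Finset.mem_union.1 hz' with h | h
        · exact hJB z h (Finset.mem_sdiff.1 hz).1
        · exact (hT' z h).1 (Finset.mem_sdiff.1 hz).1
    · rw [e1, c1]
    · intro r
      have i1 : a r ∉ R := fun h => (hR' _ h).2 r rfl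
      have i2 : b r ∉ T := fun h => (hT' _ h).2 r rfl
      have i3 : a r ∉ T := fun h => (hT' _ h).1 (haA r)
      have i4 : a r ∉ J.image b := fun h => hJB _ h (haA r)
      simp only [Finset.mem_union, Finset.mem_sdiff, ha.mem_finset_image, hb.mem_finset_image, i1,
        i2, i3, i4, haA r, hbA r]
      tauto
  · intro B hB
    simp only [Finset.mem_filter, Finset.mem_powersetCard, Finset.subset_univ, true_and] at hB
    obtain ⟨-, hBt⟩ := hB
    ext z
    simp only [Finset.mem_sdiff, Finset.mem_union, Finset.mem_image, Finset.mem_filter,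
      Finset.mem_univ, true_and, Finset.mem_inter, Finset.mem_compl]
    by_cases hz : z ∈ A
    · have : ∀ r, b r ≠ z := fun r h => hbA r (h ▸ hz)
      by_cases h : ∃ r, a r = z
      · obtain ⟨r, rfl⟩ := h
        simp [hz, this, ha.eq_iff]
      · push Not at h
        simp [hz, this, h]
    · by_cases h : ∃ r, b r = z
      · obtain ⟨r, rfl⟩ := h
        simp [hz, hb.eq_iff, hBt]
      · push Not at h
        simp [hz, h]
  · rintro ⟨t, J, R, T⟩ hx
    simp only [Finset.mem_sigma, Finset.mem_range, Finset.mem_product, Finset.mem_powersetCard,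
      Finset.subset_univ, true_and] at hx
    obtain ⟨ht, hJ, ⟨hR, hRc⟩, hT, hTc⟩ := hx
    have hR' : ∀ z ∈ R, z ∈ A ∧ ∀ r, a r ≠ z := fun z hz => by simpa using hR hz
    have hT' : ∀ z ∈ T, z ∉ A ∧ ∀ r, b r ≠ z := fun z hz => by simpa using hT hz
    have e1 : (Finset.univ.filter fun r =>
        a r ∉ (A \ (J.image a ∪ R)) ∪ (J.image b ∪ T)) = J := by
      ext r
      have i1 : a r ∉ R := fun h => (hR' _ h).2 r rfl
      have i3 : a r ∉ T := fun h => (hT' _ h).1 (haA r)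
      simp [ha.mem_finset_image, i1, i3, haA r, (hab _ _).symm]
    have e2 : (A \ Finset.univ.image a) \ ((A \ (J.image a ∪ R)) ∪ (J.image b ∪ T)) = R := by
      ext z
      have h1 : z ∈ R → z ∈ A ∧ z ∉ Finset.univ.image a := fun h => Finset.mem_sdiff.1 (hR h)
      have h2 : z ∈ T → z ∉ A := fun h => (hT' z h).1
      have h3 : z ∈ J.image b → z ∉ A := by
        simp; rintro r - rfl; exact hbA r
      have h4 : z ∈ J.image a → z ∈ Finset.univ.image a := by
        simp; rintro r - rfl; exact ⟨r, rfl⟩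
      simp only [Finset.mem_sdiff, Finset.mem_union]
      clear hr hl hab hR hT hR' hT' haA hbA ha hb e1
      tauto
    have e3 : ((A \ (J.image a ∪ R)) ∪ (J.image b ∪ T)) ∩ (Aᶜ \ Finset.univ.image b) = T := by
      ext z
      have h1 : z ∈ T → z ∉ A ∧ z ∉ Finset.univ.image b := fun h => by
        have := Finset.mem_sdiff.1 (hT h)
        exact ⟨Finset.mem_compl.1 this.1, this.2⟩
      have h2 : z ∈ J.image b → z ∈ Finset.univ.image b := by
        simp; rintro r - rfl; exact ⟨r, rfl⟩
      simp only [Finset.mem_sdiff, Finset.mem_union, Finset.mem_inter, Finset.mem_compl]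
      clear hr hl hab hR hT hR' hT' haA hbA ha hb e1 e2
      tauto
    simp only [e1, e2, e3, hJ]
  · intro B hB
    exact pairProd_eq_neg_one_pow a b B (Finset.mem_filter.1 hB).2

end Transversal

theorem card_map_sdiff_map (σ : Equiv.Perm (Fin n)) (A B : Finset (Fin n)) :
    (A.map σ.toEmbedding \ B.map σ.toEmbedding).card = (A \ B).card := by
  rw [← Finset.map_sdiff, Finset.card_map]

/-- The action of a permutation of the ground set on the `k`-subsets. -/
def KSubset.perm (σ : Equiv.Perm (Fin n)) : Equiv.Perm (KSubset n k) where
  toFun A := ⟨A.1.map σ.toEmbedding, by rw [Finset.card_map, A.2]⟩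
  invFun A := ⟨A.1.map σ.symm.toEmbedding, by rw [Finset.card_map, A.2]⟩
  left_inv A := Subtype.ext (by ext x; simp)
  right_inv A := Subtype.ext (by ext x; simp)

theorem KSubset.card_perm_sdiff_perm (σ : Equiv.Perm (Fin n)) (A B : KSubset n k) :
    ((KSubset.perm σ A).1 \ (KSubset.perm σ B).1).card = (A.1 \ B.1).card :=
  card_map_sdiff_map σ A.1 B.1

theorem KSubset.mem_perm (σ : Equiv.Perm (Fin n)) (A : KSubset n k) (x : Fin n) :
    x ∈ (KSubset.perm σ A).1 ↔ σ.symm x ∈ A.1 := by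
  change x ∈ A.1.map σ.toEmbedding ↔ _
  rw [Finset.mem_map_equiv]

theorem pairProd_perm_swap {j : ℕ} {a b : Fin j → Fin n} (ha : Function.Injective a)
    (hb : Function.Injective b) (hab : ∀ r s, a r ≠ b s) (r : Fin j) (B : KSubset n k) :
    pairProd a b (KSubset.perm (Equiv.swap (a r) (b r)) B).1 = -pairProd a b B.1 := by
  unfold pairProd
  rw [← Finset.mul_prod_erase _ _ (Finset.mem_univ r),
    ← Finset.mul_prod_erase (Finset.univ : Finset (Fin j)) _ (Finset.mem_univ r), ← neg_mul]
  congr 1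
  · simp [KSubset.mem_perm]
  · refine Finset.prod_congr rfl fun s hs => ?_
    have hs := Finset.ne_of_mem_erase hs
    simp only [KSubset.mem_perm, Equiv.symm_swap]
    rw [Equiv.swap_apply_of_ne_of_ne (fun h => hs (ha h)) (hab s r),
      Equiv.swap_apply_of_ne_of_ne (fun h => hab r s h.symm) (fun h => hs (hb h))]

/-- The eigenvector equation for the distance-`i` relation of the Johnson scheme. -/
theorem sum_pairProd {j : ℕ} {a b : Fin j → Fin n} (ha : Function.Injective a)
    (hb : Function.Injective b) (hab : ∀ r s, a r ≠ b s) (i : ℕ) (A : KSubset n k) :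
    ∑ B : KSubset n k, (if (A.1 \ B.1).card = i then pairProd a b B.1 else 0) =
      eberlein i j n k * pairProd a b A.1 := by
  by_cases hA : ∀ r, a r ∈ A.1 ↔ b r ∉ A.1
  · have hinj : ∀ u v : Fin j → Fin n, (∀ r, u r = a r ∨ u r = b r) →
        (∀ r, v r = a r ∨ v r = b r) → ∀ r s, u r = v s → r = s := by
      intro u v hu hv r s h
      rcases hu r with h1 | h1 <;> rcases hv s with h2 | h2 <;> rw [h1, h2] at h
      · exact ha h
      · exact absurd h (hab r s)
      · exact absurd h.symm (hab s r)
      · exact hb h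
    -- Each pair is reoriented so that its first point lies in `A`; the total sign of the flips is
    -- `pairProd a b A`.
    let a' : Fin j → Fin n := fun r => if a r ∈ A.1 then a r else b r
    let b' : Fin j → Fin n := fun r => if a r ∈ A.1 then b r else a r
    have ha' : ∀ r, a' r = a r ∨ a' r = b r := fun r => by
      by_cases h : a r ∈ A.1 <;> simp [a', h]
    have hb' : ∀ r, b' r = a r ∨ b' r = b r := fun r => by
      by_cases h : a r ∈ A.1 <;> simp [b', h]
    have key : ∀ B : Finset (Fin n), pairProd a b B = pairProd a b A.1 * pairProd a' b' B := by
      intro B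
      unfold pairProd
      rw [← Finset.prod_mul_distrib]
      refine Finset.prod_congr rfl fun r _ => ?_
      by_cases h : a r ∈ A.1
      · simp [a', b', h, (hA r).1 h]
      · have h' : b r ∈ A.1 := by_contra fun hn => h ((hA r).2 hn)
        simp [a', b', h, h']
    have := sum_pairProd_of_transversal (a := a') (b := b') A.2
      (fun r s h => hinj a' a' ha' ha' r s h) (fun r s h => hinj b' b' hb' hb' r s h)
      (fun r => by
        by_cases h : a r ∈ A.1
        · simp [a', h]
        · simpa [a', h] using by_contra fun hn => h ((hA r).2 hn))
      (fun r => by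
        by_cases h : a r ∈ A.1
        · simpa [b', h] using (hA r).1 h
        · simp [b', h]) i
    rw [← this, Finset.sum_filter, mul_comm, Finset.mul_sum,
      Finset.sum_subtype (p := fun B : Finset (Fin n) => B.card = k)
        (Finset.powersetCard k Finset.univ) (by simp)]
    refine Finset.sum_congr rfl fun B _ => ?_
    rw [mul_ite, mul_zero, ← key]
  · push Not at hA
    obtain ⟨r, hr⟩ := hA
    have hr : a r ∈ A.1 ↔ b r ∈ A.1 := by tauto
    rw [pairProd_eq_zero a b A.1 r hr, mul_zero]
    -- When `A` contains both or neither of `a r`, `b r`, their transposition fixes `A`, preserves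
    -- `|A \ B|` and negates the summand. The sum equals its own negative, hence vanishes.
    have hfix : KSubset.perm (Equiv.swap (a r) (b r)) A = A := by
      refine Subtype.ext (Finset.ext fun x => ?_)
      rw [KSubset.mem_perm, Equiv.symm_swap]
      by_cases h1 : x = a r
      · subst h1; simp [hr]
      by_cases h2 : x = b r
      · subst h2; simp [hr]
      rw [Equiv.swap_apply_of_ne_of_ne h1 h2]
    have := Equiv.sum_comp (KSubset.perm (k := k) (Equiv.swap (a r) (b r)))
      (fun B => if (A.1 \ B.1).card = i then pairProd a b B.1 else 0)
    have h2 : ∀ B : KSubset n k,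
        (A.1 \ (KSubset.perm (Equiv.swap (a r) (b r)) B).1).card = (A.1 \ B.1).card := by
      intro B
      conv_lhs => rw [← hfix]
      exact KSubset.card_perm_sdiff_perm _ A B
    simp only [h2, pairProd_perm_swap ha hb hab] at this
    have h3 : ∀ B : KSubset n k, (if (A.1 \ B.1).card = i then -pairProd a b B.1 else 0) =
        -(if (A.1 \ B.1).card = i then pairProd a b B.1 else 0) := fun B => by
      split_ifs <;> simp
    simp only [h3, Finset.sum_neg_distrib] at this
    linarith

/-- Taking the `a r` among the first `k` points and the `b r` among the rest is possible exactly
because `j ≤ min k (n - k)`. The set `A₀` of the first `k` points gives the value `1`; swapping one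
pair gives `-1`. The factors lie in `{-1, 0, 1}`, whence the bound. -/
theorem exists_common_eigenvector (hkn : k ≤ n) {j : ℕ} (hj : j ≤ min k (n - k)) :
    ∃ (f : KSubset n k → ℝ) (A₀ : KSubset n k), f A₀ = 1 ∧ (∀ B, f B ≤ 1) ∧
      (1 ≤ j → ∃ B, f B ≠ 1) ∧
      ∀ i A, ∑ B : KSubset n k, (if (A.1 \ B.1).card = i then f B else 0) =
        eberlein i j n k * f A := by
  have hjk := hj.trans (min_le_left _ _)
  have hjn := hj.trans (min_le_right _ _)
  let a : Fin j → Fin n := fun r => ⟨r, by omega⟩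
  let b : Fin j → Fin n := fun r => ⟨k + r, by omega⟩
  have ha : Function.Injective a := fun r s h => by
    simp only [a, Fin.mk.injEq] at h
    exact Fin.ext h
  have hb : Function.Injective b := fun r s h => by
    simp only [b, Fin.mk.injEq, Nat.add_left_cancel_iff] at h
    exact Fin.ext h
  have hab : ∀ r s, a r ≠ b s := fun r s h => by
    simp only [a, b, Fin.mk.injEq] at h
    omega
  let A₀ : KSubset n k := ⟨(Finset.univ : Finset (Fin k)).map (Fin.castLEEmb hkn), by simp⟩
  have hmem : ∀ x : Fin n, x ∈ A₀.1 ↔ (x : ℕ) < k := by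
    intro x
    simp only [A₀, Finset.mem_map, Finset.mem_univ, true_and]
    constructor
    · rintro ⟨y, rfl⟩
      simp
    · exact fun h => ⟨⟨x, h⟩, rfl⟩
  have h1 : pairProd a b A₀.1 = 1 := by
    refine Finset.prod_eq_one fun r _ => ?_
    have : (r : ℕ) < k := by omega
    simp [hmem, a, b, this]
  refine ⟨fun B => pairProd a b B.1, A₀, h1, fun B => ?_, fun hj1 => ?_, sum_pairProd ha hb hab⟩
  · refine (le_abs_self _).trans ?_
    change |pairProd a b B.1| ≤ 1
    rw [pairProd, Finset.abs_prod]
    refine Finset.prod_le_one (fun _ _ => abs_nonneg _) fun r _ => ?_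
    split_ifs <;> norm_num
  · refine ⟨KSubset.perm (Equiv.swap (a ⟨0, hj1⟩) (b ⟨0, hj1⟩)) A₀, ?_⟩
    change pairProd a b _ ≠ 1
    rw [pairProd_perm_swap ha hb hab, h1]
    norm_num

/-! ### Completeness: the algebra of invariant matrices -/

theorem eberlein_one_injOn (hkn : k ≤ n) {j l : ℕ} (hj : j ≤ min k (n - k))
    (hl : l ≤ min k (n - k)) (h : (eberlein 1 j n k : ℝ) = eberlein 1 l n k) : j = l := by
  have hjk := hj.trans (min_le_left _ _)
  have hjn := hj.trans (min_le_right _ _)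
  have hlk := hl.trans (min_le_left _ _)
  have hln := hl.trans (min_le_right _ _)
  rw [eberlein_eq 1 j hjk hjn hkn, eberlein_eq 1 l hlk hln hkn] at h
  simp [Finset.sum_range_succ, Nat.cast_sub hjk, Nat.cast_sub hlk, Nat.cast_sub hjn,
    Nat.cast_sub hln, Nat.cast_sub hkn] at h
  have a1 : (j : ℝ) ≤ k := by exact_mod_cast hjk
  have a2 : (l : ℝ) ≤ k := by exact_mod_cast hlk
  have a3 : (j : ℝ) + k ≤ n := by exact_mod_cast (by omega : j + k ≤ n)
  have a4 : (l : ℝ) + k ≤ n := by exact_mod_cast (by omega : l + k ≤ n)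
  -- Since `ℰ_1(j) = (k - j)(n - k - j) - j`, the difference of two values factors as `-(j - l)(n -
  -- j - l + 1)`; the last factor is positive.
  have h' : ((j : ℝ) - l) * (((k : ℝ) - j) + (n - k - l) + 1) = 0 := by linarith
  rcases mul_eq_zero.1 h' with h0 | h0
  · exact_mod_cast sub_eq_zero.1 h0
  · linarith

/-- Matrices indexed by `k`-subsets that are invariant under permutations of the ground set. -/
def invariantMatrices (n k : ℕ) : Subalgebra ℝ (Matrix (KSubset n k) (KSubset n k) ℝ) where
  carrier := {M | ∀ (σ : Equiv.Perm (Fin n)) (A B : KSubset n k),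
    M (KSubset.perm σ A) (KSubset.perm σ B) = M A B}
  mul_mem' := by
    intro M N hM hN σ A B
    rw [Matrix.mul_apply, Matrix.mul_apply, ← Equiv.sum_comp (KSubset.perm σ)]
    exact Finset.sum_congr rfl fun C _ => by rw [hM, hN]
  add_mem' := by
    intro M N hM hN σ A B
    rw [Matrix.add_apply, Matrix.add_apply, hM, hN]
  algebraMap_mem' := by
    intro r σ A B
    simp [Matrix.algebraMap_matrix_apply]

/-- The four cells of the Venn diagram of `A` and `B` have sizes determined by `|A \ B|`, so
bijections between corresponding cells glue to a permutation. -/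
theorem exists_perm_of_card_sdiff_eq {A B A' B' : KSubset n k}
    (h : (A.1 \ B.1).card = (A'.1 \ B'.1).card) :
    ∃ σ : Equiv.Perm (Fin n), KSubset.perm σ A = A' ∧ KSubset.perm σ B = B' := by
  let t : KSubset n k → KSubset n k → Fin n → Prop × Prop := fun A B x => (x ∈ A.1, x ∈ B.1)
  have hfib : ∀ c, Nonempty ({x // t A B x = c} ≃ {x // t A' B' x = c}) := by
    classical
    have hcard : ∀ (A B : KSubset n k) (p q : Prop), Fintype.card {x // t A B x = (p, q)} =
        if p then (if q then k - (A.1 \ B.1).card else (A.1 \ B.1).card)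
          else (if q then (A.1 \ B.1).card else n - (k + (A.1 \ B.1).card)) := by
      intro A B p q
      rw [Fintype.card_subtype]
      have h1 := card_inter_add_card_sdiff A B
      by_cases hp : p <;> by_cases hq : q
      · rw [if_pos hp, if_pos hq,
          show k - (A.1 \ B.1).card = (A.1 ∩ B.1).card from by omega]
        congr 1; ext x; simp [t, hp, hq]
      · rw [if_pos hp, if_neg hq]
        congr 1; ext x; simp [t, hp, hq]
      · rw [if_neg hp, if_pos hq, card_sdiff_comm]
        congr 1; ext x; simp [t, hp, hq, and_comm]
      · rw [if_neg hp, if_neg hq, card_sdiff_comm]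
        have hU : (A.1 ∪ B.1)ᶜ.card = n - (k + (B.1 \ A.1).card) := by
          rw [Finset.card_compl, Fintype.card_fin, ← Finset.union_sdiff_self_eq_union,
            Finset.card_union_of_disjoint Finset.disjoint_sdiff, A.2]
        rw [← hU]
        congr 1; ext x; simp [t, hp, hq]
    rintro ⟨p, q⟩
    exact ⟨Fintype.equivOfCardEq (by rw [hcard, hcard, h])⟩
  let σ := Equiv.ofFiberEquiv fun c => (hfib c).some
  have hσ : ∀ x, t A' B' (σ x) = t A B x := fun x => Equiv.ofFiberEquiv_map _ x
  refine ⟨σ, Subtype.ext (Finset.ext fun x => ?_), Subtype.ext (Finset.ext fun x => ?_)⟩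
  · have := congrArg Prod.fst (hσ (σ.symm x))
    rw [KSubset.mem_perm]
    simpa [t] using this.symm
  · have := congrArg Prod.snd (hσ (σ.symm x))
    rw [KSubset.mem_perm]
    simpa [t] using this.symm

theorem finrank_invariantMatrices_le (n k : ℕ) :
    Module.finrank ℝ (invariantMatrices n k) ≤ min k (n - k) + 1 := by
  classical
  let ρ : invariantMatrices n k →ₗ[ℝ] (Fin (min k (n - k) + 1) → ℝ) :=
    { toFun := fun M i => if h : ∃ x : KSubset n k × KSubset n k, (x.1.1 \ x.2.1).card = i then
        M.1 h.choose.1 h.choose.2 else 0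
      map_add' := fun M N => by
        funext i
        by_cases h : ∃ x : KSubset n k × KSubset n k, (x.1.1 \ x.2.1).card = i
        · simp only [dif_pos h, Pi.add_apply]; rfl
        · simp only [dif_neg h, Pi.add_apply, add_zero]
      map_smul' := fun c M => by
        funext i
        by_cases h : ∃ x : KSubset n k × KSubset n k, (x.1.1 \ x.2.1).card = i
        · simp only [dif_pos h, Pi.smul_apply]; rfl
        · simp only [dif_neg h, Pi.smul_apply, smul_zero] }
  have hρ : Function.Injective ρ := by
    rw [← LinearMap.ker_eq_bot, LinearMap.ker_eq_bot']
    intro M hM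
    refine Subtype.ext (Matrix.ext fun A B => ?_)
    have h : ∃ x : KSubset n k × KSubset n k, (x.1.1 \ x.2.1).card = (A.1 \ B.1).card :=
      ⟨(A, B), rfl⟩
    have h0 := congrFun hM ⟨(A.1 \ B.1).card, Nat.lt_succ_of_le (card_sdiff_le A B)⟩
    change (if h : ∃ x : KSubset n k × KSubset n k, (x.1.1 \ x.2.1).card = (A.1 \ B.1).card then
        M.1 h.choose.1 h.choose.2 else 0) = 0 at h0
    rw [dif_pos h] at h0
    obtain ⟨σ, h1, h2⟩ := exists_perm_of_card_sdiff_eq h.choose_spec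
    have := M.2 σ h.choose.1 h.choose.2
    rw [h1, h2, h0] at this
    exact this
  simpa using LinearMap.finrank_le_finrank_of_injective hρ

/-- The adjacency matrix of the union of the distance-`i` relations, `i ∈ S`. -/
def relMatrix (n k : ℕ) (S : Finset ℕ) : Matrix (KSubset n k) (KSubset n k) ℝ :=
  Matrix.of fun A B => if (A.1 \ B.1).card ∈ S then 1 else 0

theorem relMatrix_mem (S : Finset ℕ) : relMatrix n k S ∈ invariantMatrices n k := by
  intro σ A B
  simp [relMatrix, KSubset.card_perm_sdiff_perm]

theorem relMatrix_mulVec (S : Finset ℕ) {c : ℕ → ℝ} {f : KSubset n k → ℝ}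
    (h : ∀ i A, ∑ B : KSubset n k, (if (A.1 \ B.1).card = i then f B else 0) = c i * f A) :
    (relMatrix n k S).mulVec f = (∑ i ∈ S, c i) • f := by
  funext A
  rw [Pi.smul_apply, smul_eq_mul, Finset.sum_mul]
  simp only [← h]
  rw [Finset.sum_comm]
  change ∑ B, relMatrix n k S A B * f B = _
  refine Finset.sum_congr rfl fun B _ => ?_
  simp [relMatrix]

theorem aeval_mulVec {X : Type*} [Fintype X] [DecidableEq X] {M : Matrix X X ℝ} {f : X → ℝ}
    {μ : ℝ} (h : M.mulVec f = μ • f) (p : Polynomial ℝ) :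
    (Polynomial.aeval M p).mulVec f = p.eval μ • f := by
  induction p using Polynomial.induction_on' with
  | add p q hp hq => rw [map_add, Matrix.add_mulVec, hp, hq, Polynomial.eval_add, add_smul]
  | monomial m c =>
    have hpow : ∀ m : ℕ, (M ^ m).mulVec f = μ ^ m • f := by
      intro m
      induction m with
      | zero => simp
      | succ m ih =>
        rw [pow_succ, ← Matrix.mulVec_mulVec, h, Matrix.mulVec_smul, ih, smul_smul, pow_succ,
          mul_comm]
    rw [Polynomial.aeval_monomial, Polynomial.eval_monomial, Matrix.algebraMap_eq_diagonal,
      ← Matrix.mulVec_mulVec, hpow, mul_smul]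
    funext x
    simp [Matrix.mulVec_diagonal]

theorem aeval_mem_invariantMatrices {M : Matrix (KSubset n k) (KSubset n k) ℝ}
    (hM : M ∈ invariantMatrices n k) (p : Polynomial ℝ) :
    Polynomial.aeval M p ∈ invariantMatrices n k := by
  exact Algebra.adjoin_le (Set.singleton_subset_iff.2 hM)
    (Polynomial.aeval_mem_adjoin_singleton ℝ M)

/-- An invariant matrix annihilating all the common eigenvectors vanishes. -/
theorem eq_zero_of_forall_mulVec_eq_zero (hkn : k ≤ n)
    (f : Fin (min k (n - k) + 1) → KSubset n k → ℝ) (A₀ : Fin (min k (n - k) + 1) → KSubset n k)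
    (hf : ∀ j, f j (A₀ j) = 1)
    (h : ∀ j i A, ∑ B : KSubset n k, (if (A.1 \ B.1).card = i then f j B else 0) =
        eberlein i (j : ℕ) n k * f j A)
    {M : Matrix (KSubset n k) (KSubset n k) ℝ} (hM : M ∈ invariantMatrices n k)
    (h0 : ∀ j, M.mulVec (f j) = 0) : M = 0 := by
  let φ : invariantMatrices n k →ₗ[ℝ] (Fin (min k (n - k) + 1) → ℝ) :=
    { toFun := fun M j => M.1.mulVec (f j) (A₀ j)
      map_add' := fun M N => by
        funext j
        exact congrFun (Matrix.add_mulVec M.1 N.1 (f j)) (A₀ j)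
      map_smul' := fun c M => by
        funext j
        exact congrFun (Matrix.smul_mulVec c M.1 (f j)) (A₀ j) }
  have hsurj : Function.Surjective φ := by
    intro v
    -- Interpolating at the distinct nodes `ℰ_1(j)` yields a polynomial in the Johnson matrix with
    -- prescribed eigenvalues `v j`; these are what `φ` reads off, as `f j (A₀ j) = 1`.
    let g := Lagrange.interpolate Finset.univ
      (fun j : Fin (min k (n - k) + 1) => (eberlein 1 (j : ℕ) n k : ℝ)) v
    refine ⟨⟨Polynomial.aeval (relMatrix n k {1}) g,
      aeval_mem_invariantMatrices (relMatrix_mem _) g⟩, ?_⟩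
    funext j
    change (Polynomial.aeval (relMatrix n k {1}) g).mulVec (f j) (A₀ j) = v j
    rw [aeval_mulVec (relMatrix_mulVec {1} (h j)), Finset.sum_singleton, Pi.smul_apply, hf,
      smul_eq_mul, mul_one]
    refine Lagrange.eval_interpolate_at_node
      (v := fun j : Fin (min k (n - k) + 1) => (eberlein 1 (j : ℕ) n k : ℝ)) v (fun i _ l _ hil => Fin.ext ?_) (Finset.mem_univ j)
    exact eberlein_one_injOn hkn (Nat.le_of_lt_succ i.2) (Nat.le_of_lt_succ l.2) hil
  -- Surjectivity and the orbit bound force equal dimensions, so `φ` is also injective.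
  have hrank : Module.finrank ℝ (invariantMatrices n k) =
      Module.finrank ℝ (Fin (min k (n - k) + 1) → ℝ) := by
    refine le_antisymm ?_ (LinearMap.finrank_le_finrank_of_surjective hsurj)
    simpa using finrank_invariantMatrices_le n k
  have hinj := (LinearMap.injective_iff_surjective_of_finrank_eq_finrank hrank).2 hsurj
  have : (⟨M, hM⟩ : invariantMatrices n k) = 0 := by
    apply hinj
    rw [map_zero]
    funext j
    exact congrFun (h0 j) (A₀ j)
  exact congrArg Subtype.val this

/-! ### Spectrum of a union of relations, and its extreme eigenvalues -/

theorem hasEigenvalue_relMatrix_iff (hkn : k ≤ n) (S : Finset ℕ) (μ : ℝ) :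
    Module.End.HasEigenvalue (Matrix.toLin' (relMatrix n k S)) μ ↔
      ∃ j : ℕ, j ≤ min k (n - k) ∧ μ = ∑ i ∈ S, (eberlein i j n k : ℝ) := by
  constructor
  · intro hμ
    obtain ⟨v, hv⟩ := hμ.exists_hasEigenvector
    have hv1 : (relMatrix n k S).mulVec v = μ • v := by
      simpa using hv.apply_eq_smul
    choose f A₀ hf _ _ h using fun j : Fin (min k (n - k) + 1) =>
      exists_common_eigenvector hkn (Nat.le_of_lt_succ j.2)
    -- Each factor kills one of the common eigenvectors, so `p` annihilates the matrix and every
    -- eigenvalue is a root of `p`.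
    let p : Polynomial ℝ := ∏ j : Fin (min k (n - k) + 1),
      (Polynomial.X - Polynomial.C (∑ i ∈ S, (eberlein i (j : ℕ) n k : ℝ)))
    have hp : Polynomial.aeval (relMatrix n k S) p = 0 := by
      refine eq_zero_of_forall_mulVec_eq_zero hkn f A₀ hf h
        (aeval_mem_invariantMatrices (relMatrix_mem S) p) fun j => ?_
      rw [aeval_mulVec (relMatrix_mulVec S (h j)), Polynomial.eval_prod,
        Finset.prod_eq_zero (Finset.mem_univ j) (by
          rw [Polynomial.eval_sub, Polynomial.eval_X, Polynomial.eval_C, sub_self]), zero_smul]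
    have := aeval_mulVec hv1 p
    rw [hp, Matrix.zero_mulVec] at this
    rcases smul_eq_zero.1 this.symm with h0 | h0
    · rw [Polynomial.eval_prod] at h0
      obtain ⟨j, _, hj⟩ := Finset.prod_eq_zero_iff.1 h0
      refine ⟨j, Nat.le_of_lt_succ j.2, ?_⟩
      rwa [Polynomial.eval_sub, Polynomial.eval_X, Polynomial.eval_C, sub_eq_zero] at hj
    · exact absurd h0 hv.2
  · rintro ⟨j, hj, rfl⟩
    obtain ⟨f, A₀, hf, _, _, h⟩ := exists_common_eigenvector hkn hj
    refine Module.End.hasEigenvalue_of_hasEigenvector (x := f) ⟨?_, ?_⟩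
    · rw [Module.End.mem_eigenspace_iff, Matrix.toLin'_apply]
      exact relMatrix_mulVec S h
    · rintro rfl
      simp at hf

theorem eberlein_zero (i : ℕ) (hkn : k ≤ n) :
    (eberlein i 0 n k : ℝ) = (k.choose i : ℝ) * ((n - k).choose i : ℝ) := by
  have := eberlein_eq (n := n) i 0 (Nat.zero_le k) (Nat.zero_le _) hkn
  rw [Nat.cast_zero] at this
  rw [this, Finset.sum_eq_single 0]
  · simp
  · intro t _ ht
    obtain ⟨t, rfl⟩ := Nat.exists_eq_succ_of_ne_zero ht
    simp
  · simp

/-- For `j = 0` the eigenvector is an empty product, the constant `1`, so its eigenvalue is the row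
sum. -/
theorem sum_relMatrix (S : Finset ℕ) (A : KSubset n k) :
    ∑ B, relMatrix n k S A B = ∑ i ∈ S, (eberlein i 0 n k : ℝ) := by
  have h : ∀ i (A : KSubset n k), ∑ B : KSubset n k,
      (if (A.1 \ B.1).card = i then (fun _ => 1 : KSubset n k → ℝ) B else 0) =
        (eberlein i 0 n k : ℝ) * (fun _ => 1 : KSubset n k → ℝ) A := by
    intro i A
    have := sum_pairProd (j := 0) (a := (Fin.elim0 : Fin 0 → Fin n)) (b := Fin.elim0)
      (fun r => r.elim0) (fun r => r.elim0) (fun r => r.elim0) i A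
    simpa [pairProd] using this
  have := congrFun (relMatrix_mulVec S h) A
  simpa [Matrix.mulVec, dotProduct] using this

/-- At a point where the eigenvector attains its maximum `1`, the eigenvalue is a sum of at most the
row entries. -/
theorem sum_eberlein_le (hkn : k ≤ n) (S : Finset ℕ) {j : ℕ} (hj : j ≤ min k (n - k)) :
    ∑ i ∈ S, (eberlein i j n k : ℝ) ≤ ∑ i ∈ S, (eberlein i 0 n k : ℝ) := by
  obtain ⟨f, A₀, hf, hle, _, h⟩ := exists_common_eigenvector hkn hj
  have h1 := congrFun (relMatrix_mulVec S h) A₀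
  rw [Pi.smul_apply, hf, smul_eq_mul, mul_one] at h1
  rw [← h1, ← sum_relMatrix S A₀]
  change ∑ B, relMatrix n k S A₀ B * f B ≤ _
  refine Finset.sum_le_sum fun B _ => mul_le_of_le_one_right ?_ (hle B)
  simp only [relMatrix, Matrix.of_apply]
  split_ifs <;> norm_num

/-- Equality would force the value `1` to spread from a vertex to all its neighbours, hence along
walks to every vertex, but the eigenvector is not constantly `1`. -/
theorem sum_eberlein_ne (hkn : k ≤ n) (S : Finset ℕ) {G : SimpleGraph (KSubset n k)}
    (hG : G.Preconnected) (hadj : ∀ A B, G.Adj A B ↔ (A.1 \ B.1).card ∈ S)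
    {j : ℕ} (hj1 : 1 ≤ j) (hj : j ≤ min k (n - k)) :
    ∑ i ∈ S, (eberlein i j n k : ℝ) ≠ ∑ i ∈ S, (eberlein i 0 n k : ℝ) := by
  intro heq
  obtain ⟨f, A₀, hf, hle, hne, h⟩ := exists_common_eigenvector hkn hj
  obtain ⟨B₀, hB₀⟩ := hne hj1
  have hstep : ∀ A B, G.Adj A B → f A = 1 → f B = 1 := by
    intro A B hAB hA
    have h1 := congrFun (relMatrix_mulVec S h) A
    rw [Pi.smul_apply, hA, smul_eq_mul, mul_one, heq, ← sum_relMatrix S A] at h1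
    change ∑ B, relMatrix n k S A B * f B = _ at h1
    have h2 := (Finset.sum_eq_sum_iff_of_le fun B _ => mul_le_of_le_one_right (by
      simp only [relMatrix, Matrix.of_apply]
      split_ifs <;> norm_num) (hle B)).1 h1 B (Finset.mem_univ B)
    simpa [relMatrix, (hadj A B).1 hAB] using h2
  have hwalk : ∀ A B, G.Walk A B → f A = 1 → f B = 1 := by
    intro A B w
    induction w with
    | nil => exact id
    | cons hAC _ ih => exact fun hA => ih (hstep _ _ hAC hA)
  obtain ⟨w⟩ := hG A₀ B₀
  exact hB₀ (hwalk _ _ w hf)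

/-- Otherwise the matrix would be positive semidefinite with trace zero, hence zero, contradicting
the edge. -/
theorem exists_neg_mem_adjSpec {V : Type*} [Fintype V] {G : SimpleGraph V} {u v : V}
    (h : G.Adj u v) : ∃ μ ∈ adjSpec G, μ < 0 := by
  classical
  have hH : (G.adjMatrix ℝ).IsHermitian := by
    rw [Matrix.IsHermitian, Matrix.conjTranspose_eq_transpose_of_trivial]
    exact SimpleGraph.transpose_adjMatrix (α := ℝ) G
  by_contra! hcon
  have hpsd : (G.adjMatrix ℝ).PosSemidef := by
    rw [hH.posSemidef_iff_eigenvalues_nonneg]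
    intro i
    refine hcon _ ?_
    change Module.End.HasEigenvalue _ _
    rw [Module.End.hasEigenvalue_iff_mem_spectrum, Matrix.spectrum_toLin']
    convert hH.eigenvalues_mem_spectrum_real i
  have h0 := hpsd.trace_eq_zero_iff.1 (SimpleGraph.trace_adjMatrix ℝ G)
  have := congrFun (congrFun h0 u) v
  simp [h] at this

theorem adjSpec_eq (hkn : k ≤ n) (S : Finset ℕ) {G : SimpleGraph (KSubset n k)}
    (hadj : ∀ A B, G.Adj A B ↔ (A.1 \ B.1).card ∈ S) :
    adjSpec G = {μ : ℝ | ∃ j : ℕ, j ≤ min k (n - k) ∧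
      μ = ∑ i ∈ S, (eberlein i j n k : ℝ)} := by
  classical
  ext μ
  have hM : G.adjMatrix ℝ = relMatrix n k S := by
    ext A B
    simp [relMatrix, SimpleGraph.adjMatrix_apply, hadj]
  rw [Set.mem_ofPred_eq, ← hasEigenvalue_relMatrix_iff hkn, ← hM]
  change Module.End.HasEigenvalue _ _ ↔ _
  convert Iff.rfl

/-- The spectrum of a connected union of relations of the Johnson scheme. -/
theorem spectrum_of_preconnected (hkn : k ≤ n) (hpos : 1 ≤ min k (n - k)) (S : Finset ℕ)
    {G : SimpleGraph (KSubset n k)} (hG : G.Preconnected)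
    (hadj : ∀ A B, G.Adj A B ↔ (A.1 \ B.1).card ∈ S) :
    adjSpec G = {μ : ℝ | ∃ j : ℕ, j ≤ min k (n - k) ∧
        μ = ∑ i ∈ S, (eberlein i j n k : ℝ)} ∧
      (∑ i ∈ S, (eberlein i 0 n k : ℝ)) =
          ∑ i ∈ S, (k.choose i : ℝ) * ((n - k).choose i : ℝ) ∧
      IsGreatest (adjSpec G) (∑ i ∈ S, (k.choose i : ℝ) * ((n - k).choose i : ℝ)) ∧
      adjSpec G \ {∑ i ∈ S, (k.choose i : ℝ) * ((n - k).choose i : ℝ)} =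
          {μ : ℝ | ∃ j : ℕ, 1 ≤ j ∧ j ≤ min k (n - k) ∧
            μ = ∑ i ∈ S, (eberlein i j n k : ℝ)} ∧
      ∃ μ : ℝ, IsLeast (adjSpec G) μ ∧ μ < 0 := by
  have hspec := adjSpec_eq hkn S hadj
  have h0 : (∑ i ∈ S, (eberlein i 0 n k : ℝ)) =
      ∑ i ∈ S, (k.choose i : ℝ) * ((n - k).choose i : ℝ) :=
    Finset.sum_congr rfl fun i _ => eberlein_zero i hkn
  refine ⟨hspec, h0, ?_, ?_, ?_⟩
  · rw [← h0, hspec]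
    refine ⟨⟨0, Nat.zero_le _, by rw [Nat.cast_zero]⟩, ?_⟩
    rintro _ ⟨j, hj, rfl⟩
    exact sum_eberlein_le hkn S hj
  · rw [← h0, hspec]
    ext μ
    constructor
    · rintro ⟨⟨j, hj, rfl⟩, hne⟩
      refine ⟨j, ?_, hj, rfl⟩
      rw [Nat.one_le_iff_ne_zero]
      rintro rfl
      exact hne (by rw [Set.mem_singleton_iff, Nat.cast_zero])
    · rintro ⟨j, hj1, hj, rfl⟩
      exact ⟨⟨j, hj, rfl⟩, sum_eberlein_ne hkn S hG hadj hj1 hj⟩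
  -- The eigenvector for `j = 1` takes different values at two vertices, so a walk between them has
  -- a first edge.
  · obtain ⟨f, A₀, hf, _, hne, _⟩ := exists_common_eigenvector (j := 1) hkn hpos
    obtain ⟨B₀, hB₀⟩ := hne le_rfl
    obtain ⟨w⟩ := hG A₀ B₀
    obtain ⟨C, hC⟩ : ∃ C, G.Adj A₀ C := by
      cases w with
      | nil => exact absurd hf hB₀
      | cons h _ => exact ⟨_, h⟩
    obtain ⟨ν, hν, hneg⟩ := exists_neg_mem_adjSpec hC
    have hfin : (adjSpec G).Finite := by
      rw [hspec]
      refine ((Finset.range (min k (n - k) + 1)).finite_toSet.image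
        fun j : ℕ => ∑ i ∈ S, (eberlein i j n k : ℝ)).subset ?_
      rintro _ ⟨j, hj, rfl⟩
      exact ⟨j, by simpa [Nat.lt_succ_iff] using hj, rfl⟩
    obtain ⟨μ, hμ, hmin⟩ := Set.exists_min_image (adjSpec G) id hfin ⟨ν, hν⟩
    exact ⟨μ, ⟨hμ, fun x hx => hmin x hx⟩, (hmin ν hν).trans_lt hneg⟩

end GraphPower

theorem lemma4p2 (k : ℕ) (hk : 1 ≤ k) :
    (∀ n p : ℕ, k ≤ n → 1 ≤ p → p ≤ min k (n - k) →
      GraphPower.adjSpec (GraphPower.power (GraphPower.johnson n k) p) =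
          {μ : ℝ | ∃ j : ℕ, j ≤ min k (n - k) ∧
            μ = ∑ i ∈ Finset.Icc 1 p, (GraphPower.eberlein i j n k : ℝ)} ∧
      (∑ i ∈ Finset.Icc 1 p, (GraphPower.eberlein i 0 n k : ℝ)) =
          ∑ i ∈ Finset.Icc 1 p, (k.choose i : ℝ) * ((n - k).choose i : ℝ) ∧
      IsGreatest (GraphPower.adjSpec (GraphPower.power (GraphPower.johnson n k) p))
          (∑ i ∈ Finset.Icc 1 p, (k.choose i : ℝ) * ((n - k).choose i : ℝ)) ∧
      GraphPower.adjSpec (GraphPower.power (GraphPower.johnson n k) p) \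
            {∑ i ∈ Finset.Icc 1 p, (k.choose i : ℝ) * ((n - k).choose i : ℝ)} =
          {μ : ℝ | ∃ j : ℕ, 1 ≤ j ∧ j ≤ min k (n - k) ∧
            μ = ∑ i ∈ Finset.Icc 1 p, (GraphPower.eberlein i j n k : ℝ)} ∧
      ∃ μ : ℝ, IsLeast (GraphPower.adjSpec (GraphPower.power (GraphPower.johnson n k) p)) μ ∧
        μ < 0) ∧
    (∀ n p : ℕ, 2 * k < n → 1 ≤ p → p ≤ (k - 1) ⌈/⌉ (n - 2 * k) + 1 →
      GraphPower.adjSpec (GraphPower.power (GraphPower.kneser n k) p) =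
          {μ : ℝ | ∃ j : ℕ, j ≤ k ∧
            μ = ∑ i ∈ GraphPower.deltaPreimage n k p, (GraphPower.eberlein i j n k : ℝ)} ∧
      (∑ i ∈ GraphPower.deltaPreimage n k p, (GraphPower.eberlein i 0 n k : ℝ)) =
          ∑ i ∈ GraphPower.deltaPreimage n k p, (k.choose i : ℝ) * ((n - k).choose i : ℝ) ∧
      IsGreatest (GraphPower.adjSpec (GraphPower.power (GraphPower.kneser n k) p))
          (∑ i ∈ GraphPower.deltaPreimage n k p, (k.choose i : ℝ) * ((n - k).choose i : ℝ)) ∧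
      GraphPower.adjSpec (GraphPower.power (GraphPower.kneser n k) p) \
            {∑ i ∈ GraphPower.deltaPreimage n k p,
              (k.choose i : ℝ) * ((n - k).choose i : ℝ)} =
          {μ : ℝ | ∃ j : ℕ, 1 ≤ j ∧ j ≤ k ∧
            μ = ∑ i ∈ GraphPower.deltaPreimage n k p, (GraphPower.eberlein i j n k : ℝ)} ∧
      ∃ μ : ℝ, IsLeast (GraphPower.adjSpec (GraphPower.power (GraphPower.kneser n k) p)) μ ∧
        μ < 0) := by
  refine ⟨fun n p hkn hp hpm => ?_, fun n p hn hp _ => ?_⟩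
  · exact GraphPower.spectrum_of_preconnected hkn (hp.trans hpm) (Finset.Icc 1 p)
      (GraphPower.power_preconnected GraphPower.johnson_preconnected hp)
      (GraphPower.power_johnson_adj_iff p)
  · have hmin : min k (n - k) = k := min_eq_left (by omega)
    have := GraphPower.spectrum_of_preconnected (n := n) (k := k) (by omega) (by omega)
      (GraphPower.deltaPreimage n k p)
      (GraphPower.power_preconnected (GraphPower.kneser_preconnected hk hn) hp)
      (GraphPower.power_kneser_adj_iff hk hn p)
    rwa [hmin] at this
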